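/- Let $\mathcal H$ be a real Hilbert space and $A,B:\mathcal H\rightrightarrows\mathcal H$ set-valued operators. For $\alpha\in\mathbb R$, $A$ is *$\alpha$-monotone* if $\langle x-y,u-v\rangle\ge\alpha\|x-y\|^2$ whenever $u\in A(x)$, $v\in A(y)$, and *maximally $\alpha$-monotone* if in addition its graph is not properly contained in the graph of another $\alpha$-monotone operator. Write $\operatorname{zer}A=\{x:0\in A(x)\}$ and $\operatorname{Fix}A=\{x: x\in A(x)\}$. **Theorem (weak convergence of the shadow sequence under monotonicity).** Let $A$ be maximally $\alpha$-monotone and $B$ maximally $\beta$-monotone, where $\alpha,\beta\in\mathbb R$, $\alpha+\beta\ge0$ and $\operatorname{zer}(A+B)\ne\varnothing$. Let $\gamma,\delta>0$, $\lambda=1+\delta/\gamma$, $\mu=1+\gamma/\delta$, and suppose that $$\delta(1+2\gamma\alpha)=\gamma\ \text{ if }\alpha+\beta=0,\qquad (\gamma+\delta)^2<4\gamma\delta(1+\gamma\alpha)(1+\delta\beta)\ \text{ if }\alpha+\beta>0.$$ Let $0<\kappa<\overline\kappa$, where $$\overline\kappa=\begin{cases}1,&\alpha+\beta=0,\\[2pt]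 \dfrac{4\gamma\delta(1+\gamma\alpha)(1+\delta\beta)-(\gamma+\delta)^2}{2\gamma\delta(\gamma+\delta)(\alpha+\beta)},&\alpha+\beta>0.\end{cases}$$ Set $J_1=(\operatorname{Id}+\gamma A)^{-1}$, $J_2=(\operatorname{Id}+\delta B)^{-1}$, $R_1=(1-\lambda)\operatorname{Id}+\lambda J_1$, $R_2=(1-\mu)\operatorname{Id}+\mu J_2$, and let $T=(1-\kappa)\operatorname{Id}+\kappa R_2R_1$ be the adaptive Douglas–Rachford operator. Then $J_1$ and $T$ are single-valued with full domain $\mathcal H$, and for every starting point $x_0\in\mathcal H$ the sequence $x_{k+1}=T(x_k)$, $k=0,1,2,\dots$, converges weakly to some $x^\star\in\operatorname{Fix}T$, and the shadow sequence converges weakly: $$J_1(x_k)\rightharpoonup J_1(x^\star)\in\operatorname{zer}(A+B).$$ -/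

import Mathlib

open scoped Pointwise Topology
open Filter

/-- A set-valued operator `A : H ⇉ H`.  Sums `A + B` and scalar multiples `γ • A` are the pointwise
(Minkowski) ones: `(A + B) x = A x + B x` and `(γ • A) x = γ • A x`. -/
abbrev SetValuedOp (H : Type*) := H → Set H

namespace SetValuedOp

section Basic

variable {H : Type*}

/-- The graph `{(x, u) | u ∈ A x}`. -/
def gra (A : SetValuedOp H) : Set (H × H) := {p | p.2 ∈ A p.1}

/-- The set of fixed points `{x | x ∈ A x}`. -/
def Fix (A : SetValuedOp H) : Set H := {x | x ∈ A x}

/-- The set of zeros `{x | 0 ∈ A x}`. -/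
def zer [Zero H] (A : SetValuedOp H) : Set H := {x | 0 ∈ A x}

/-- The inverse operator: `x ∈ A⁻¹ u` if and only if `u ∈ A x`. -/
def inv (A : SetValuedOp H) : SetValuedOp H := fun u => {x | u ∈ A x}

/-- The identity operator. -/
def ident (H : Type*) : SetValuedOp H := fun x => {x}

/-- The composition `B A`, that is `x ↦ ⋃ y ∈ A x, B y`. -/
def comp (B A : SetValuedOp H) : SetValuedOp H := fun x => ⋃ y ∈ A x, B y

end Basic

variable {H : Type*} [NormedAddCommGroup H] [InnerProductSpace ℝ H]

/-- `α`-monotonicity: `⟪x - y, u - v⟫ ≥ α ‖x - y‖²` for all `(x, u), (y, v) ∈ gra A`. -/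
def IsMonotone (α : ℝ) (A : SetValuedOp H) : Prop :=
  ∀ x u y v : H, (x, u) ∈ A.gra → (y, v) ∈ A.gra → inner ℝ (x - y) (u - v) ≥ α * ‖x - y‖ ^ 2

/-- Maximal `α`-monotonicity: `A` is `α`-monotone and its graph is not properly contained in the
graph of an `α`-monotone operator. -/
def IsMaximallyMonotone (α : ℝ) (A : SetValuedOp H) : Prop :=
  A.IsMonotone α ∧ ¬ ∃ B : SetValuedOp H, B.IsMonotone α ∧ A.gra ⊂ B.gra

/-- The resolvent `J_A = (Id + A)⁻¹`. -/
def resolvent (A : SetValuedOp H) : SetValuedOp H := (ident H + A).inv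

/-- The relaxed resolvent `(1 - lam) Id + lam J_A`. -/
def relaxedResolvent (lam : ℝ) (A : SetValuedOp H) : SetValuedOp H :=
  (1 - lam) • ident H + lam • A.resolvent

/-- The adaptive Douglas–Rachford operator `(1 - κ) Id + κ R₂ R₁`, where `R₁` is the relaxed
resolvent of `γ A` with parameter `lam` and `R₂` that of `δ B` with parameter `mu`. -/
def aDR (A B : SetValuedOp H) (γ δ lam mu κ : ℝ) : SetValuedOp H :=
  (1 - κ) • ident H + κ • comp (relaxedResolvent mu (δ • B)) (relaxedResolvent lam (γ • A))

end SetValuedOp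

/-- The bound `κ̄` on the relaxation parameter (used for `α + β ≥ 0`). -/
noncomputable def kappaBar (α β γ δ : ℝ) : ℝ :=
  open Classical in
  if α + β = 0 then 1
  else (4 * γ * δ * (1 + γ * α) * (1 + δ * β) - (γ + δ) ^ 2) /
    (2 * γ * δ * (γ + δ) * (α + β))

/-- Weak convergence of a sequence: convergence in the weak topology. -/
def WeaklyConverges {H : Type*} [NormedAddCommGroup H] [InnerProductSpace ℝ H]
    (x : ℕ → H) (a : H) : Prop :=
  Tendsto (fun k => toWeakSpace ℝ H (x k)) atTop (𝓝 (toWeakSpace ℝ H a))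

/-!
Convergence of the adaptive Douglas–Rachford iteration.  For `z : H` put `x = J₁ z`,
`a = (z - x) / γ ∈ A x`, `y = J₂ (R₁ z)` and `b ∈ B y` the corresponding element.  The choice of
`lam` and `mu` gives `R₁ z = x - δ a`, `x - y = δ (a + b)` and `T z = z - κ mu (x - y)`, so that the
fixed points of `T` are the points `z = p + γ c` with `c ∈ A p` and `-c ∈ B p`.

The argument rests on four facts.

* The resolvents are everywhere defined and single-valued because `1 + γ α` and `1 + δ β` are
  positive (`one_add_mul_pos`).  Surjectivity is Minty's theorem
  (`exists_mem_neg_of_maximal_monotone`), obtained by minimising the Fitzpatrick function of the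
  graph plus half the squared norm; strong convexity provides the minimiser, with no compactness.
* Adding the two monotonicity inequalities shows that `w = x - y` is cocoercive relative to the
  fixed points: `c ‖w z‖² ≤ ⟪z - p, w z⟫` (`le_inner_of_le_inner`, `exists_lt_mul_norm_sub_sq_le`),
  with `κ mu < 2 c` exactly because `κ < kappaBar`.  Hence the iterates are Fejér monotone with
  respect to `Fix T` and `w (x k) → 0`.
* In a weak limit of `(x k, J₁ (x k))`, the monotonicity inequalities of `A` and `B` are to be
  added before passing to the limit: the products that are not weakly continuous cancel, and
  `-(α + β) ‖·‖²` is weakly upper semicontinuous (`nonneg_of_weak_limit`).  Testing the result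
  at resolvent points (`mem_of_weak_limit`) shows that a weak limit `(z, q)` satisfies
  `q = J₁ z` and `z ∈ Fix T`.  This holds for all `α + β ≥ 0` at once.
* Opial's lemma (`exists_tendsto_inner_of_dist_tendsto`), phrased with ultrafilters, turns this into
  weak convergence of the whole sequence, and then of its shadow.
-/

/-! ### Weak convergence in a Hilbert space -/

section Weak

variable {H : Type*} [NormedAddCommGroup H] [InnerProductSpace ℝ H] [CompleteSpace H]

theorem tendsto_toWeakSpace_iff_inner {ι : Type*} {l : Filter ι} {x : ι → H} {a : H} :
    Tendsto (fun k => toWeakSpace ℝ H (x k)) l (𝓝 (toWeakSpace ℝ H a)) ↔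
      ∀ v, Tendsto (fun k => inner ℝ (x k) v) l (𝓝 (inner ℝ a v)) := by
  have hinj : Function.Injective (topDualPairing ℝ H).flip := by
    intro x y hxy
    refine ext_inner_left ℝ fun v => ?_
    have := LinearMap.congr_fun hxy (InnerProductSpace.toDual ℝ H v)
    simpa using this
  refine (WeakBilin.tendsto_iff_forall_eval_tendsto (topDualPairing ℝ H).flip hinj).trans ?_
  refine ⟨fun h v => ?_, fun h f => ?_⟩
  · have := h (InnerProductSpace.toDual ℝ H v)
    simp only [real_inner_comm v]
    exact this
  · have := h ((InnerProductSpace.toDual ℝ H).symm f)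
    simp only [real_inner_comm ((InnerProductSpace.toDual ℝ H).symm f),
      InnerProductSpace.toDual_symm_apply] at this
    exact this

/-- Bounded families in a Hilbert space have a weak limit along every ultrafilter
(Banach–Alaoglu transported through the Riesz isomorphism). -/
theorem exists_tendsto_inner_of_norm_le {ι : Type*} (U : Ultrafilter ι) {x : ι → H} {R : ℝ}
    (hx : ∀ k, ‖x k‖ ≤ R) :
    ∃ a : H, ∀ v, Tendsto (fun k => inner ℝ (x k) v) U (𝓝 (inner ℝ a v)) := by
  obtain ⟨f, -, hf⟩ := (WeakDual.isCompact_closedBall (𝕜 := ℝ) (E := H) 0 R).ultrafilter_le_nhds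
    (U.map fun k => StrongDual.toWeakDual (InnerProductSpace.toDual ℝ H (x k))) (by
      rw [Ultrafilter.coe_map, le_principal_iff, mem_map]
      refine univ_mem' fun k => ?_
      simpa using hx k)
  refine ⟨(InnerProductSpace.toDual ℝ H).symm (WeakDual.toStrongDual f), fun v => ?_⟩
  rw [InnerProductSpace.toDual_symm_apply]
  exact (WeakDual.eval_continuous v).continuousAt.tendsto.comp hf

/-- **Opial's lemma**: if the distances to each point of `S` converge and all weak ultrafilter
limits lie in `S`, then the sequence converges weakly to a point of `S`. -/
theorem exists_tendsto_inner_of_dist_tendsto {x : ℕ → H} {S : Set H}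
    (hdist : ∀ p ∈ S, ∃ r, Tendsto (fun k => ‖x k - p‖ ^ 2) atTop (𝓝 r))
    {R : ℝ} (hx : ∀ k, ‖x k‖ ≤ R)
    (hlim : ∀ U : Ultrafilter ℕ, (U : Filter ℕ) ≤ atTop → ∀ a : H,
      (∀ v, Tendsto (fun k => inner ℝ (x k) v) U (𝓝 (inner ℝ a v))) → a ∈ S) :
    ∃ a ∈ S, ∀ v, Tendsto (fun k => inner ℝ (x k) v) atTop (𝓝 (inner ℝ a v)) := by
  obtain ⟨U₀, hU₀⟩ := Ultrafilter.exists_le (atTop : Filter ℕ)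
  obtain ⟨a, ha⟩ := exists_tendsto_inner_of_norm_le U₀ hx
  have haS := hlim U₀ hU₀ a ha
  refine ⟨a, haS, fun v => ?_⟩
  rw [tendsto_iff_ultrafilter]
  intro U hU
  obtain ⟨b, hb⟩ := exists_tendsto_inner_of_norm_le U hx
  have hbS := hlim U hU b hb
  obtain ⟨r, hr⟩ := hdist a haS
  obtain ⟨s, hs⟩ := hdist b hbS
  -- `⟪x k, b - a⟫` is an affine function of the difference of the two squared distances,
  -- so it converges, and its limits along `U₀` and `U` agree.
  have key : Tendsto (fun k => inner ℝ (x k) (b - a)) atTop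
      (𝓝 ((r - s - ‖a‖ ^ 2 + ‖b‖ ^ 2) / 2)) := by
    refine ((((hr.sub hs).sub_const _).add_const _).div_const 2).congr fun k => ?_
    rw [norm_sub_sq_real, norm_sub_sq_real, inner_sub_right]
    ring
  have h1 := tendsto_nhds_unique (ha (b - a)) (key.mono_left hU₀)
  have h2 := tendsto_nhds_unique (hb (b - a)) (key.mono_left hU)
  have h3 : inner ℝ (b - a) (b - a) = 0 := by
    rw [inner_sub_left, h1, h2, sub_self]
  rw [inner_self_eq_zero, sub_eq_zero] at h3
  exact h3 ▸ hb v

end Weak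

/-! ### Minimisation over a closed convex epigraph -/

section Minimisation

variable {E : Type*} [NormedAddCommGroup E] [InnerProductSpace ℝ E] [CompleteSpace E]

/-- A strongly convex lower semicontinuous function `g p + ‖p‖² / 2`, presented through the
epigraph `C` of `g`, attains its infimum.  Strong convexity makes minimising sequences Cauchy. -/
theorem exists_isMinOn_add_half_norm_sq {C : Set (E × ℝ)} (hne : C.Nonempty) (hC : Convex ℝ C)
    (hcl : IsClosed C) {m : ℝ} (hm : ∀ q ∈ C, m ≤ q.2 + ‖q.1‖ ^ 2 / 2) :
    ∃ q ∈ C, ∀ q' ∈ C, q.2 + ‖q.1‖ ^ 2 / 2 ≤ q'.2 + ‖q'.1‖ ^ 2 / 2 := by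
  set f : E × ℝ → ℝ := fun q => q.2 + ‖q.1‖ ^ 2 / 2 with hf
  have hbdd : BddBelow (f '' C) := ⟨m, by rintro _ ⟨q, hq, rfl⟩; exact hm q hq⟩
  set I := sInf (f '' C) with hI
  have hIle : ∀ q ∈ C, I ≤ f q := fun q hq => csInf_le hbdd ⟨q, hq, rfl⟩
  have hex : ∀ n : ℕ, ∃ q ∈ C, f q < I + 1 / ((n : ℝ) + 1) := by
    intro n
    obtain ⟨_, ⟨q, hq, rfl⟩, hlt⟩ := exists_lt_of_csInf_lt (hne.image f)
      (lt_add_of_pos_right I (Nat.one_div_pos_of_nat (n := n) (α := ℝ)))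
    exact ⟨q, hq, hlt⟩
  choose q hqC hq using hex
  have hmid : ∀ a ∈ C, ∀ b ∈ C, ‖a.1 - b.1‖ ^ 2 ≤ 4 * (f a + f b - 2 * I) := by
    intro a ha b hb
    have h := hIle _ (hC ha hb (a := 1 / 2) (b := 1 / 2) (by norm_num) (by norm_num)
      (by norm_num))
    simp only [hf, Prod.fst_add, Prod.snd_add, Prod.smul_fst, Prod.smul_snd, smul_eq_mul,
      ← smul_add, norm_smul, mul_pow] at h ⊢
    have hp := parallelogram_law_with_norm ℝ a.1 b.1
    norm_num at h
    nlinarith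
  have hcau : CauchySeq fun n => (q n).1 := by
    refine cauchySeq_of_le_tendsto_0 (fun n : ℕ => √(8 * (1 / ((n : ℝ) + 1)))) ?_ ?_
    · intro n k N hn hk
      rw [dist_eq_norm]
      refine Real.le_sqrt_of_sq_le ((hmid _ (hqC n) _ (hqC k)).trans ?_)
      have hn' := (hq n).trans_le (add_le_add_right (Nat.one_div_le_one_div (α := ℝ) hn) I)
      have hk' := (hq k).trans_le (add_le_add_right (Nat.one_div_le_one_div (α := ℝ) hk) I)
      linarith
    · have := ((tendsto_one_div_add_atTop_nhds_zero_nat (𝕜 := ℝ)).const_mul 8).sqrt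
      simpa using this
  obtain ⟨p, hp⟩ := cauchySeq_tendsto_of_complete hcau
  have hfI : Tendsto (fun n => f (q n)) atTop (𝓝 I) := by
    refine tendsto_of_tendsto_of_tendsto_of_le_of_le tendsto_const_nhds ?_
      (fun n => hIle _ (hqC n)) (fun n => (hq n).le)
    simpa using (tendsto_one_div_add_atTop_nhds_zero_nat (𝕜 := ℝ)).const_add I
  have ht : Tendsto (fun n => (q n).2) atTop (𝓝 (I - ‖p‖ ^ 2 / 2)) := by
    refine (hfI.sub ((hp.norm.pow 2).div_const 2)).congr fun n => ?_
    simp [hf]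
  refine ⟨(p, I - ‖p‖ ^ 2 / 2), hcl.mem_of_tendsto (hp.prodMk_nhds ht)
    (Eventually.of_forall hqC), fun q' hq' => ?_⟩
  simpa using hIle q' hq'

/-- First-order optimality for the minimisation of `g p + ‖p‖² / 2`: the minimiser `q.1`
satisfies `-q.1 ∈ ∂g q.1`. -/
theorem exists_mem_forall_le_add_inner {C : Set (E × ℝ)} (hne : C.Nonempty) (hC : Convex ℝ C)
    (hcl : IsClosed C) {m : ℝ} (hm : ∀ q ∈ C, m ≤ q.2 + ‖q.1‖ ^ 2 / 2) :
    ∃ q ∈ C, ∀ q' ∈ C, q.2 ≤ q'.2 + inner ℝ q.1 (q'.1 - q.1) := by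
  obtain ⟨q, hq, hmin⟩ := exists_isMinOn_add_half_norm_sq hne hC hcl hm
  refine ⟨q, hq, fun q' hq' => ?_⟩
  set D := q'.2 - q.2 + inner ℝ q.1 (q'.1 - q.1) with hD
  have hs : ∀ n : ℕ, 0 ≤ D + 1 / ((n : ℝ) + 1) * (‖q'.1 - q.1‖ ^ 2 / 2) := by
    intro n
    have hpos : 0 < 1 / ((n : ℝ) + 1) := Nat.one_div_pos_of_nat
    have hle : 1 / ((n : ℝ) + 1) ≤ 1 := by
      rw [div_le_one (by positivity)]; linarith [n.cast_nonneg (α := ℝ)]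
    set s := 1 / ((n : ℝ) + 1)
    have h := hmin _ (hC.add_smul_sub_mem hq hq' ⟨hpos.le, hle⟩)
    simp only [Prod.fst_add, Prod.snd_add, Prod.smul_fst, Prod.smul_snd, smul_eq_mul,
      Prod.fst_sub, Prod.snd_sub, norm_add_sq_real, norm_smul, mul_pow, inner_smul_right,
      Real.norm_eq_abs, sq_abs] at h
    refine nonneg_of_mul_nonneg_right (a := s) ?_ hpos
    rw [hD]
    linarith
  have hlim : Tendsto (fun n : ℕ => D + 1 / ((n : ℝ) + 1) * (‖q'.1 - q.1‖ ^ 2 / 2)) atTop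
      (𝓝 D) := by
    simpa using ((tendsto_one_div_add_atTop_nhds_zero_nat (𝕜 := ℝ)).mul_const
      (‖q'.1 - q.1‖ ^ 2 / 2)).const_add D
  have := ge_of_tendsto' hlim hs
  linarith

end Minimisation

/-! ### Minty's theorem -/

section Minty

variable {H : Type*} [NormedAddCommGroup H] [InnerProductSpace ℝ H] [CompleteSpace H]

/-- **Minty's theorem**, for a maximally monotone graph `G`: there is `x` with `0 ∈ x + G x`.
The minimiser `(a, b)` of the Fitzpatrick function plus half the squared norm satisfies
`(-b, -a) ∈ G` and `b = -a`. -/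
theorem exists_mem_neg_of_maximal_monotone {G : Set (H × H)} (hne : G.Nonempty)
    (hmono : ∀ p ∈ G, ∀ q ∈ G, 0 ≤ inner ℝ (p.1 - q.1) (p.2 - q.2))
    (hmax : ∀ p : H × H, (∀ q ∈ G, 0 ≤ inner ℝ (p.1 - q.1) (p.2 - q.2)) → p ∈ G) :
    ∃ x, (x, -x) ∈ G := by
  -- the epigraph of the Fitzpatrick function of `G`
  set C : Set (WithLp 2 (H × H) × ℝ) :=
    {w | ∀ q ∈ G, inner ℝ w.1.fst q.2 + inner ℝ q.1 w.1.snd - inner ℝ q.1 q.2 ≤ w.2} with hCdef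
  have hCne : C.Nonempty := by
    obtain ⟨p, hp⟩ := hne
    refine ⟨(WithLp.toLp 2 p, inner ℝ p.1 p.2), fun q hq => ?_⟩
    have := hmono p hp q hq
    simp only [inner_sub_left, inner_sub_right] at this
    simp only [WithLp.toLp_fst, WithLp.toLp_snd]
    linarith
  have hCconv : Convex ℝ C := by
    intro w hw w' hw' s t hs ht hst q hq
    have h1 := mul_le_mul_of_nonneg_left (hw q hq) hs
    have h2 := mul_le_mul_of_nonneg_left (hw' q hq) ht
    simp only [Prod.fst_add, Prod.snd_add, Prod.smul_fst, Prod.smul_snd, smul_eq_mul,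
      WithLp.add_fst, WithLp.add_snd, WithLp.smul_fst, WithLp.smul_snd, inner_add_left,
      inner_add_right, inner_smul_left, inner_smul_right, RCLike.conj_to_real]
    obtain rfl : t = 1 - s := by linarith
    linarith
  have hCcl : IsClosed C := by
    simp only [hCdef, Set.ofPred_forall]
    refine isClosed_iInter fun q => isClosed_iInter fun _ => isClosed_le ?_ continuous_snd
    have h1 : Continuous fun w : WithLp 2 (H × H) × ℝ => w.1.fst :=
      (WithLp.continuous_fst 2 H H).comp continuous_fst
    have h2 : Continuous fun w : WithLp 2 (H × H) × ℝ => w.1.snd :=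
      (WithLp.continuous_snd 2 H H).comp continuous_fst
    fun_prop
  -- maximality: the Fitzpatrick function dominates the duality pairing
  have hCge : ∀ w ∈ C, inner ℝ w.1.fst w.1.snd ≤ w.2 := by
    intro w hw
    by_contra! hlt
    have hmem : (w.1.fst, w.1.snd) ∈ G := hmax _ fun q hq => by
      have := hw q hq
      simp only [inner_sub_left, inner_sub_right]
      linarith
    have := hw _ hmem
    simp only at this
    linarith
  have hCbdd : ∀ w ∈ C, 0 ≤ w.2 + ‖w.1‖ ^ 2 / 2 := by
    intro w hw
    have h1 := hCge w hw
    have h2 : 0 ≤ ‖w.1.fst + w.1.snd‖ ^ 2 := by positivity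
    rw [norm_add_sq_real] at h2
    rw [WithLp.prod_norm_sq_eq_of_L2]
    linarith
  obtain ⟨w, hw, hopt⟩ := exists_mem_forall_le_add_inner hCne hCconv hCcl hCbdd
  set a := w.1.fst with ha
  set b := w.1.snd with hb
  have hab := hCge w hw
  have hkey : ∀ q ∈ G, ‖a + b‖ ^ 2 ≤ inner ℝ (q.1 + b) (q.2 + a) := by
    intro q hq
    have h := hopt (WithLp.toLp 2 q, inner ℝ q.1 q.2) fun q' hq' => by
      have := hmono q hq q' hq'
      simp only [inner_sub_left, inner_sub_right] at this
      simp only [WithLp.toLp_fst, WithLp.toLp_snd]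
      linarith
    rw [inner_sub_right, WithLp.prod_inner_apply, WithLp.prod_inner_apply] at h
    change w.2 ≤ inner ℝ q.1 q.2 + (inner ℝ a q.1 + inner ℝ b q.2 -
      (inner ℝ a a + inner ℝ b b)) at h
    rw [real_inner_self_eq_norm_sq, real_inner_self_eq_norm_sq] at h
    rw [norm_add_sq_real]
    simp only [inner_add_left, inner_add_right]
    rw [real_inner_comm a q.1, real_inner_comm a b]
    linarith
  have hmem : (-b, -a) ∈ G := hmax _ fun q hq => by
    have h1 := hkey q hq
    have h2 : 0 ≤ ‖a + b‖ ^ 2 := by positivity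
    rw [← inner_neg_neg]
    simpa [add_comm] using h2.trans h1
  have h0 := hkey _ hmem
  simp only [neg_add_cancel, inner_zero_left] at h0
  have h1 : a + b = 0 := by
    rw [← norm_eq_zero, ← sq_eq_zero_iff]
    exact le_antisymm h0 (by positivity)
  refine ⟨a, ?_⟩
  rwa [← eq_neg_of_add_eq_zero_left h1] at hmem

end Minty

/-! ### Set-valued operators and their resolvents -/

namespace SetValuedOp

section Graph

variable {H : Type*} [NormedAddCommGroup H] [InnerProductSpace ℝ H]

theorem IsMonotone.le_inner {α : ℝ} {A : SetValuedOp H} (hA : A.IsMonotone α) {x u y v : H}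
    (hu : u ∈ A x) (hv : v ∈ A y) : α * ‖x - y‖ ^ 2 ≤ inner ℝ (x - y) (u - v) :=
  hA x u y v hu hv

theorem IsMaximallyMonotone.mem_of_forall {α : ℝ} {A : SetValuedOp H}
    (hA : A.IsMaximallyMonotone α) {x u : H}
    (h : ∀ y v, v ∈ A y → α * ‖x - y‖ ^ 2 ≤ inner ℝ (x - y) (u - v)) : u ∈ A x := by
  by_contra hn
  refine hA.2 ⟨fun y => {v | v ∈ A y ∨ (y = x ∧ v = u)}, ?_, ?_⟩
  · rintro y v z w (hv | ⟨rfl, rfl⟩) (hw | ⟨rfl, rfl⟩)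
    · exact hA.1 _ _ _ _ hv hw
    · have := h y v hv
      rw [← inner_neg_neg, neg_sub, neg_sub, norm_sub_rev]
      exact this
    · exact h z w hw
    · simp
  · refine ⟨fun p hp => Or.inl hp, fun hsub => hn ?_⟩
    exact hsub (show (x, u) ∈ _ from Or.inr ⟨rfl, rfl⟩)

theorem mem_resolvent_smul_iff {A : SetValuedOp H} {γ : ℝ} (hγ : γ ≠ 0) {x z : H} :
    x ∈ (γ • A : SetValuedOp H).resolvent z ↔ γ⁻¹ • (z - x) ∈ A x := by
  change z ∈ ({x} : Set H) + γ • A x ↔ _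
  rw [Set.singleton_add, Set.mem_image, ← Set.mem_smul_set_iff_inv_smul_mem₀ hγ]
  constructor
  · rintro ⟨w, hw, rfl⟩
    simpa using hw
  · intro h
    exact ⟨_, h, by simp⟩

/-- Strong monotonicity of `Id + γ A`. -/
theorem IsMonotone.mul_norm_sub_sq_le {α γ : ℝ} {A : SetValuedOp H} (hA : A.IsMonotone α)
    (hγ : 0 < γ) {x y z z' : H} (hx : γ⁻¹ • (z - x) ∈ A x) (hy : γ⁻¹ • (z' - y) ∈ A y) :
    (1 + γ * α) * ‖x - y‖ ^ 2 ≤ inner ℝ (x - y) (z - z') := by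
  have h := hA.le_inner hx hy
  rw [← smul_sub, inner_smul_right, ← div_eq_inv_mul, le_div_iff₀ hγ,
    sub_sub_sub_comm, inner_sub_right, real_inner_self_eq_norm_sq] at h
  linarith

theorem IsMonotone.mul_norm_sub_le {α γ : ℝ} {A : SetValuedOp H} (hA : A.IsMonotone α)
    (hγ : 0 < γ) {x y z z' : H} (hx : γ⁻¹ • (z - x) ∈ A x) (hy : γ⁻¹ • (z' - y) ∈ A y) :
    (1 + γ * α) * ‖x - y‖ ≤ ‖z - z'‖ := by
  have h := (hA.mul_norm_sub_sq_le hγ hx hy).trans (real_inner_le_norm _ _)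
  rcases (norm_nonneg (x - y)).eq_or_lt with h0 | h0
  · simp [← h0]
  · refine le_of_mul_le_mul_left ?_ h0
    linarith

theorem IsMonotone.eq_of_mem {α γ : ℝ} {A : SetValuedOp H} (hA : A.IsMonotone α)
    (hγ : 0 < γ) (hα : 0 < 1 + γ * α) {x y z : H} (hx : γ⁻¹ • (z - x) ∈ A x)
    (hy : γ⁻¹ • (z - y) ∈ A y) : x = y := by
  have h := hA.mul_norm_sub_le hγ hx hy
  rw [sub_self, norm_zero] at h
  exact sub_eq_zero.1 (norm_le_zero_iff.1 (nonpos_of_mul_nonpos_right h hα))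

theorem IsMonotone.resolvent_eq_singleton {α γ : ℝ} {A : SetValuedOp H} (hA : A.IsMonotone α)
    (hγ : 0 < γ) (hα : 0 < 1 + γ * α) {x z : H} (hx : γ⁻¹ • (z - x) ∈ A x) :
    (γ • A : SetValuedOp H).resolvent z = {x} := by
  ext y
  rw [mem_resolvent_smul_iff hγ.ne', Set.mem_singleton_iff]
  exact ⟨fun hy => hA.eq_of_mem hγ hα hy hx, fun hy => hy ▸ hx⟩

end Graph

section Resolvent

variable {H : Type*} [NormedAddCommGroup H] [InnerProductSpace ℝ H] [CompleteSpace H]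

/-- The resolvent of `γ A` is defined everywhere when `1 + γ α > 0`: Minty's theorem applied to
a maximally monotone affine transform of the graph of `A`. -/
theorem IsMaximallyMonotone.exists_mem_resolvent {α γ : ℝ} {A : SetValuedOp H}
    (hA : A.IsMaximallyMonotone α) (hγ : 0 < γ) (hα : 0 < 1 + γ * α) (z : H) :
    ∃ x, γ⁻¹ • (z - x) ∈ A x := by
  set c := 1 + γ * α with hc
  have hcγ : 0 < γ⁻¹ * c := by positivity
  have hsub : ∀ p q : H × H, inner ℝ (p.1 - q.1)
      (γ⁻¹ • (c • p.2 + z) + α • p.1 - (γ⁻¹ • (c • q.2 + z) + α • q.1)) =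
      γ⁻¹ * c * inner ℝ (p.1 - q.1) (p.2 - q.2) + α * ‖p.1 - q.1‖ ^ 2 := by
    intro p q
    rw [show γ⁻¹ • (c • p.2 + z) + α • p.1 - (γ⁻¹ • (c • q.2 + z) + α • q.1) =
      (γ⁻¹ * c) • (p.2 - q.2) + α • (p.1 - q.1) by module, inner_add_right, inner_smul_right,
      inner_smul_right, real_inner_self_eq_norm_sq]
  have hinv : ∀ y v : H, γ⁻¹ • (c • (c⁻¹ • (γ • (v - α • y) - z)) + z) + α • y = v := by
    intro y v
    rw [smul_inv_smul₀ hα.ne', sub_add_cancel, inv_smul_smul₀ hγ.ne', sub_add_cancel]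
  suffices h : ∃ x, (x, -x) ∈ {p : H × H | γ⁻¹ • (c • p.2 + z) + α • p.1 ∈ A p.1} by
    obtain ⟨x, hx⟩ := h
    refine ⟨x, ?_⟩
    have : γ⁻¹ • (c • (-x) + z) + α • x = γ⁻¹ • (z - x) := by
      rw [hc, ← sub_eq_zero]
      match_scalars <;> field_simp <;> ring
    simpa only [Set.mem_ofPred_eq, this] using hx
  apply exists_mem_neg_of_maximal_monotone
  · obtain ⟨y, v, hv⟩ : ∃ y v, v ∈ A y := by
      by_contra! hne
      exact hne 0 0 (hA.mem_of_forall fun y v hv => absurd hv (hne y v))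
    exact ⟨(y, c⁻¹ • (γ • (v - α • y) - z)), by simpa only [Set.mem_ofPred_eq, hinv] using hv⟩
  · intro p hp q hq
    have h := hA.1.le_inner hp hq
    rw [hsub] at h
    exact nonneg_of_mul_nonneg_right (by linarith) hcγ
  · intro p hp
    refine hA.mem_of_forall fun y v hv => ?_
    have h := hp (y, c⁻¹ • (γ • (v - α • y) - z))
      (by simpa only [Set.mem_ofPred_eq, hinv] using hv)
    have h2 := hsub p (y, c⁻¹ • (γ • (v - α • y) - z))
    simp only [hinv] at h2
    rw [h2]
    have := mul_nonneg hcγ.le h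
    linarith

end Resolvent

end SetValuedOp

/-! ### Demiclosedness for the sum of two operators -/

section Demiclosed

variable {H : Type*} [NormedAddCommGroup H] [InnerProductSpace ℝ H]

theorem tendsto_inner_zero_of_norm_le {ι : Type*} {l : Filter ι} {x s : ι → H} {R : ℝ}
    (hx : ∀ k, ‖x k‖ ≤ R) (hs : Tendsto s l (𝓝 0)) :
    Tendsto (fun k => inner ℝ (x k) (s k)) l (𝓝 0) := by
  refine squeeze_zero_norm (fun k => (norm_inner_le_norm _ _).trans
    (mul_le_mul_of_nonneg_right (hx k) (norm_nonneg _))) ?_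
  simpa using hs.norm.const_mul R

namespace SetValuedOp

/-- Passing to the limit in the sum of the two monotonicity inequalities.  The products
`⟪x k, a k⟫` cancel, and `-(α + β) ‖x k‖ ^ 2` is weakly upper semicontinuous. -/
theorem nonneg_of_weak_limit {ι : Type*} {l : Filter ι} [l.NeBot] {α β : ℝ}
    {A B : SetValuedOp H} (hA : A.IsMonotone α) (hB : B.IsMonotone β) (hαβ : 0 ≤ α + β)
    {x w a s : ι → H} {R : ℝ} (hxR : ∀ k, ‖x k‖ ≤ R) (haR : ∀ k, ‖a k‖ ≤ R)
    (hxa : ∀ k, a k ∈ A (x k)) (hyb : ∀ k, s k - a k ∈ B (x k - w k))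
    (hw : Tendsto w l (𝓝 0)) (hs : Tendsto s l (𝓝 0)) {p c : H}
    (hp : ∀ v, Tendsto (fun k => inner ℝ (x k) v) l (𝓝 (inner ℝ p v)))
    (hc : ∀ v, Tendsto (fun k => inner ℝ (a k) v) l (𝓝 (inner ℝ c v)))
    {u a' v b' : H} (hu : a' ∈ A u) (hv : b' ∈ B v) :
    0 ≤ inner ℝ (p - u) (c - a') - α * ‖p - u‖ ^ 2 +
      (inner ℝ (p - v) (-c - b') - β * ‖p - v‖ ^ 2) := by
  -- `g k` collects the terms that vanish in the limit
  set g : ι → ℝ := fun k => inner ℝ (x k) (s k) + 2 * β * inner ℝ (x k) (w k)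
    + inner ℝ (a k) (w k) - inner ℝ (w k) (s k) + inner ℝ (w k) b' - inner ℝ (s k) v
    - β * ‖w k‖ ^ 2 - 2 * β * inner ℝ (w k) v with hg
  have hg0 : Tendsto g l (𝓝 0) := by
    have h1 := tendsto_inner_zero_of_norm_le hxR hs
    have h2 := (tendsto_inner_zero_of_norm_le hxR hw).const_mul (2 * β)
    have h3 := tendsto_inner_zero_of_norm_le haR hw
    have h4 := hw.inner (𝕜 := ℝ) hs
    have h5 := hw.inner (𝕜 := ℝ) (tendsto_const_nhds (x := b'))
    have h6 := hs.inner (𝕜 := ℝ) (tendsto_const_nhds (x := v))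
    have h7 := (hw.norm.pow 2).const_mul β
    have h8 := (hw.inner (𝕜 := ℝ) (tendsto_const_nhds (x := v))).const_mul (2 * β)
    have := ((((((h1.add h2).add h3).sub h4).add h5).sub h6).sub h7).sub h8
    simpa using this
  have hle : ∀ k, 0 ≤ -inner ℝ (x k) a' - inner ℝ (a k) u + inner ℝ u a'
      + 2 * α * inner ℝ (x k) u - α * ‖u‖ ^ 2 - inner ℝ (x k) b' + inner ℝ (a k) v
      + inner ℝ v b' + 2 * β * inner ℝ (x k) v - β * ‖v‖ ^ 2
      - (α + β) * (2 * inner ℝ (x k) p - ‖p‖ ^ 2) + g k := by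
    intro k
    have h1 := hA.le_inner (hxa k) hu
    have h2 := hB.le_inner (hyb k) hv
    have h3 : 0 ≤ (α + β) * ‖x k - p‖ ^ 2 := by positivity
    rw [sub_right_comm (x k), sub_right_comm (s k)] at h2
    simp only [norm_sub_sq_real, inner_sub_left, inner_sub_right] at h1 h2 h3
    simp only [hg]
    rw [real_inner_comm (a k) (x k), real_inner_comm u (a k)] at *
    simp only [real_inner_comm (w k) (x k), real_inner_comm (w k) (a k), real_inner_comm v (a k),
      real_inner_comm v (s k), real_inner_comm v (w k)] at *
    linarith
  have hlim := ((((((((((((hp a').neg.sub (hc u)).add_const (inner ℝ u a')).add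
    ((hp u).const_mul (2 * α))).sub_const (α * ‖u‖ ^ 2)).sub (hp b')).add (hc v)).add_const
    (inner ℝ v b')).add ((hp v).const_mul (2 * β))).sub_const (β * ‖v‖ ^ 2)).sub
    ((((hp p).const_mul 2).sub_const (‖p‖ ^ 2)).const_mul (α + β))).add hg0)
  have h := ge_of_tendsto' hlim hle
  rw [real_inner_self_eq_norm_sq] at h
  simp only [norm_sub_sq_real, inner_sub_left, inner_sub_right, inner_neg_right]
  rw [real_inner_comm c u, real_inner_comm c v] at *
  linarith

variable [CompleteSpace H]

/-- Testing the limit inequality at the resolvent points of `p + γ c` and `p - δ c` forces both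
of them to be `p`. -/
theorem mem_of_weak_limit {ι : Type*} {l : Filter ι} [l.NeBot] {α β γ δ : ℝ}
    {A B : SetValuedOp H} (hA : A.IsMaximallyMonotone α) (hB : B.IsMaximallyMonotone β)
    (hαβ : 0 ≤ α + β) (hγ : 0 < γ) (hδ : 0 < δ) (hα : 0 < 1 + γ * α) (hβ : 0 < 1 + δ * β)
    {x w a s : ι → H} {R : ℝ} (hxR : ∀ k, ‖x k‖ ≤ R) (haR : ∀ k, ‖a k‖ ≤ R)
    (hxa : ∀ k, a k ∈ A (x k)) (hyb : ∀ k, s k - a k ∈ B (x k - w k))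
    (hw : Tendsto w l (𝓝 0)) (hs : Tendsto s l (𝓝 0)) {p c : H}
    (hp : ∀ v, Tendsto (fun k => inner ℝ (x k) v) l (𝓝 (inner ℝ p v)))
    (hc : ∀ v, Tendsto (fun k => inner ℝ (a k) v) l (𝓝 (inner ℝ c v))) :
    c ∈ A p ∧ -c ∈ B p := by
  obtain ⟨u, hu⟩ := hA.exists_mem_resolvent hγ hα (p + γ • c)
  obtain ⟨v, hv⟩ := hB.exists_mem_resolvent hδ hβ (p + δ • (-c))
  have h := nonneg_of_weak_limit hA.1 hB.1 hαβ hxR haR hxa hyb hw hs hp hc hu hv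
  have e1 : γ⁻¹ • (p + γ • c - u) = c + γ⁻¹ • (p - u) := by
    match_scalars <;> field_simp
  have e2 : δ⁻¹ • (p + δ • (-c) - v) = -c + δ⁻¹ • (p - v) := by
    match_scalars <;> field_simp
  rw [e1] at h hu
  rw [e2] at h hv
  rw [sub_add_cancel_left, sub_add_cancel_left, inner_neg_right, inner_neg_right,
    inner_smul_right, inner_smul_right, real_inner_self_eq_norm_sq,
    real_inner_self_eq_norm_sq] at h
  have hα' : 0 < γ⁻¹ + α := by
    have : γ⁻¹ + α = γ⁻¹ * (1 + γ * α) := by field_simp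
    rw [this]; positivity
  have hβ' : 0 < δ⁻¹ + β := by
    have : δ⁻¹ + β = δ⁻¹ * (1 + δ * β) := by field_simp
    rw [this]; positivity
  have h1 : 0 ≤ (γ⁻¹ + α) * ‖p - u‖ ^ 2 := by positivity
  have h2 : 0 ≤ (δ⁻¹ + β) * ‖p - v‖ ^ 2 := by positivity
  have z1 : (γ⁻¹ + α) * ‖p - u‖ ^ 2 = 0 := by linarith
  have z2 : (δ⁻¹ + β) * ‖p - v‖ ^ 2 = 0 := by linarith
  simp only [mul_eq_zero, hα'.ne', hβ'.ne', false_or, sq_eq_zero_iff, norm_eq_zero] at z1 z2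
  obtain rfl := sub_eq_zero.1 z1
  obtain rfl := sub_eq_zero.1 z2
  exact ⟨by simpa using hu, by simpa using hv⟩

end SetValuedOp

end Demiclosed

/-! ### The basic inequality for the adaptive Douglas–Rachford step -/

section Quadratic

variable {H : Type*} [NormedAddCommGroup H] [InnerProductSpace ℝ H]

/-- With the largest admissible `c`, the difference of the two sides times `p + q - m` is the
square `‖(p - m / 2) • X + (q - m / 2) • Y‖ ^ 2`. -/
theorem mul_norm_sub_sq_le_of_discrim {p q m c : ℝ} (hs : 0 < p + q - m)
    (hc : c * (p + q - m) = p * q - m ^ 2 / 4) (X Y : H) :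
    c * ‖X - Y‖ ^ 2 ≤ p * ‖X‖ ^ 2 - m * inner ℝ X Y + q * ‖Y‖ ^ 2 := by
  refine le_of_mul_le_mul_left ?_ hs
  have h : 0 ≤ ‖(p - m / 2) • X + (q - m / 2) • Y‖ ^ 2 := by positivity
  rw [norm_add_sq_real, norm_smul, norm_smul, mul_pow, mul_pow, inner_smul_left,
    inner_smul_right, RCLike.conj_to_real, Real.norm_eq_abs, Real.norm_eq_abs, sq_abs, sq_abs] at h
  rw [norm_sub_sq_real]
  linear_combination h + (‖X‖ ^ 2 - 2 * inner ℝ X Y + ‖Y‖ ^ 2) * hc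

/-- The quadratic form produced by a step dominates `c ‖X - Y‖ ^ 2` for some `c` with
`κ (1 + γ / δ) < 2 c`; `kappaBar` is exactly the threshold for such a `c` to exist. -/
theorem exists_lt_mul_norm_sub_sq_le {α β γ δ κ : ℝ} (hαβ : 0 ≤ α + β) (hγ : 0 < γ) (hδ : 0 < δ)
    (h_zero : α + β = 0 → δ * (1 + 2 * γ * α) = γ) (hκ : κ < kappaBar α β γ δ) :
    ∃ c : ℝ, κ * (1 + γ / δ) < 2 * c ∧ ∀ X Y : H, c * ‖X - Y‖ ^ 2 ≤
      (1 + γ * α) * ‖X‖ ^ 2 - (1 + γ / δ) * inner ℝ X Y + γ / δ * (1 + δ * β) * ‖Y‖ ^ 2 := by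
  have hm : 0 < 1 + γ / δ := by positivity
  rcases hαβ.eq_or_lt with h0 | h0
  · have hz := h_zero h0.symm
    rw [kappaBar, if_pos h0.symm] at hκ
    refine ⟨(1 + γ / δ) / 2, by nlinarith, fun X Y => ?_⟩
    have hβ : β = -α := by linarith
    have h1 : 1 + γ * α = (1 + γ / δ) / 2 := by
      field_simp; linarith
    have h2 : γ / δ * (1 + δ * β) = (1 + γ / δ) / 2 := by
      rw [hβ]; field_simp; linarith
    rw [h1, h2, norm_sub_sq_real]
    linarith
  · rw [kappaBar, if_neg h0.ne'] at hκ
    have hs : 1 + γ * α + γ / δ * (1 + δ * β) - (1 + γ / δ) = γ * (α + β) := by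
      field_simp; ring
    have hspos : 0 < γ * (α + β) := by positivity
    refine ⟨((1 + γ * α) * (γ / δ * (1 + δ * β)) - (1 + γ / δ) ^ 2 / 4) / (γ * (α + β)), ?_,
      fun X Y => mul_norm_sub_sq_le_of_discrim (hs ▸ hspos) ?_ X Y⟩
    · refine (mul_lt_mul_of_pos_right hκ hm).trans_eq ?_
      field_simp
      ring
    · rw [hs, div_mul_cancel₀ _ hspos.ne']

/-- The two monotonicity inequalities bound `⟪Z, X - Y⟫` below by a quadratic form
in `X` and `Y`. -/
theorem le_inner_of_le_inner {α β γ δ : ℝ} (hγ : 0 < γ) {X Y Z a b : H}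
    (hZ : Z = X + γ • a) (hb : b = δ⁻¹ • (X - Y) - a)
    (ha : α * ‖X‖ ^ 2 ≤ inner ℝ X a) (hb' : β * ‖Y‖ ^ 2 ≤ inner ℝ Y b) (hδ : δ ≠ 0) :
    (1 + γ * α) * ‖X‖ ^ 2 - (1 + γ / δ) * inner ℝ X Y + γ / δ * (1 + δ * β) * ‖Y‖ ^ 2 ≤
      inner ℝ Z (X - Y) := by
  subst hZ hb
  rw [inner_sub_right, inner_smul_right, inner_sub_right, real_inner_self_eq_norm_sq] at hb'
  rw [inner_add_left, inner_smul_left, inner_sub_right, inner_sub_right,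
    real_inner_self_eq_norm_sq, RCLike.conj_to_real, real_inner_comm X a, real_inner_comm Y a]
  rw [real_inner_comm X Y] at hb'
  have h := mul_le_mul_of_nonneg_left (add_le_add ha hb') hγ.le
  have e : γ / δ * (1 + δ * β) = γ * δ⁻¹ + γ * β := by field_simp
  rw [e, div_eq_mul_inv]
  linarith

end Quadratic

/-! ### Convergence of the iteration -/

section Iteration

variable {H : Type*} [NormedAddCommGroup H] [InnerProductSpace ℝ H]

/-- Fejér monotonicity of a relaxed iteration with cocoercive displacement `w`. -/
theorem norm_sub_smul_sub_sq_le {c t : ℝ} (ht : 0 ≤ t) {z p v : H}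
    (h : c * ‖v‖ ^ 2 ≤ inner ℝ (z - p) v) :
    ‖z - t • v - p‖ ^ 2 + t * (2 * c - t) * ‖v‖ ^ 2 ≤ ‖z - p‖ ^ 2 := by
  rw [sub_right_comm, norm_sub_sq_real, inner_smul_right, norm_smul, mul_pow, Real.norm_eq_abs,
    sq_abs]
  linarith [mul_le_mul_of_nonneg_left h ht]

theorem tendsto_zero_of_add_mul_le {d e : ℕ → ℝ} {ε r : ℝ} (hε : 0 < ε) (he : ∀ k, 0 ≤ e k)
    (h : ∀ k, d (k + 1) + ε * e k ≤ d k) (hd : Tendsto d atTop (𝓝 r)) :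
    Tendsto e atTop (𝓝 0) := by
  refine squeeze_zero he (g := fun k => (d k - d (k + 1)) / ε) (fun k => ?_) ?_
  · rw [le_div_iff₀ hε]; linarith [h k]
  · simpa using (hd.sub (hd.comp (tendsto_add_atTop_nat 1))).div_const ε

namespace SetValuedOp

/-- The displacement `w` of the unrelaxed step vanishes at `z` as soon as `z = p + γ c` with
`c ∈ A p` and `-c ∈ B p`; then `p` is the shadow `J z`. -/
theorem eq_and_eq_zero_of_mem {α β γ δ : ℝ} {A B : SetValuedOp H} (hA : A.IsMonotone α)
    (hB : B.IsMonotone β) (hγ : 0 < γ) (hδ : 0 < δ) (hα : 0 < 1 + γ * α) (hβ : 0 < 1 + δ * β)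
    {J w : H → H} (hJA : ∀ z, γ⁻¹ • (z - J z) ∈ A (J z))
    (hJB : ∀ z, δ⁻¹ • w z - γ⁻¹ • (z - J z) ∈ B (J z - w z)) {z p : H}
    (hp : γ⁻¹ • (z - p) ∈ A p) (hp' : -(γ⁻¹ • (z - p)) ∈ B p) : J z = p ∧ w z = 0 := by
  obtain rfl := hA.eq_of_mem hγ hα (hJA z) hp
  refine ⟨rfl, ?_⟩
  -- `J z` and `J z - w z` are both the `δ B`-resolvent of the same point
  have e1 : δ⁻¹ • ((J z - δ • γ⁻¹ • (z - J z)) - (J z - w z)) =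
      δ⁻¹ • w z - γ⁻¹ • (z - J z) := by
    match_scalars <;> field_simp <;> ring
  have e2 : δ⁻¹ • ((J z - δ • γ⁻¹ • (z - J z)) - J z) = -(γ⁻¹ • (z - J z)) := by
    match_scalars <;> field_simp <;> ring
  have h := hB.eq_of_mem hδ hβ (e1 ▸ hJB z) (e2 ▸ hp')
  simpa using h

variable [CompleteSpace H]

/-- Weak convergence of `x (k + 1) = x k - t • w (x k)` and of its shadow `J (x k)`: the zeros of
the cocoercive displacement `w` are the weak limits of the iterates (demiclosedness), and the
weak limit of the shadow along any ultrafilter is determined by that of the iterates. -/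
theorem exists_weak_limit_of_iterate {α β γ δ c t : ℝ} {A B : SetValuedOp H}
    (hA : A.IsMaximallyMonotone α) (hB : B.IsMaximallyMonotone β)
    (hαβ : 0 ≤ α + β) (hγ : 0 < γ) (hδ : 0 < δ) (hα : 0 < 1 + γ * α) (hβ : 0 < 1 + δ * β)
    {J w : H → H} (hJA : ∀ z, γ⁻¹ • (z - J z) ∈ A (J z))
    (hJB : ∀ z, δ⁻¹ • w z - γ⁻¹ • (z - J z) ∈ B (J z - w z))
    (hcoc : ∀ z p, w p = 0 → c * ‖w z‖ ^ 2 ≤ inner ℝ (z - p) (w z))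
    (ht : 0 < t) (htc : t < 2 * c) (hfix : ∃ p, w p = 0)
    {x : ℕ → H} (hx : ∀ k, x (k + 1) = x k - t • w (x k)) :
    ∃ xs, w xs = 0 ∧ (∀ v, Tendsto (fun k => inner ℝ (x k) v) atTop (𝓝 (inner ℝ xs v))) ∧
      ∀ v, Tendsto (fun k => inner ℝ (J (x k)) v) atTop (𝓝 (inner ℝ (J xs) v)) := by
  obtain ⟨p, hp⟩ := hfix
  have hε : 0 < t * (2 * c - t) := mul_pos ht (sub_pos.2 htc)
  have hstep : ∀ q, w q = 0 → ∀ k,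
      ‖x (k + 1) - q‖ ^ 2 + t * (2 * c - t) * ‖w (x k)‖ ^ 2 ≤ ‖x k - q‖ ^ 2 := by
    intro q hq k
    rw [hx]
    exact norm_sub_smul_sub_sq_le ht.le (hcoc _ _ hq)
  have hanti : ∀ q, w q = 0 → Antitone fun k => ‖x k - q‖ ^ 2 := fun q hq =>
    antitone_nat_of_succ_le fun k => by
      have h1 := hstep q hq k
      have h2 : 0 ≤ t * (2 * c - t) * ‖w (x k)‖ ^ 2 := by positivity
      linarith
  have hdist : ∀ q ∈ {q | w q = 0}, ∃ r, Tendsto (fun k => ‖x k - q‖ ^ 2) atTop (𝓝 r) :=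
    fun q hq => ⟨_, tendsto_atTop_ciInf (hanti q hq)
      ⟨0, by rintro _ ⟨k, rfl⟩; positivity⟩⟩
  obtain ⟨r, hr⟩ := hdist p hp
  have hw : Tendsto (fun k => w (x k)) atTop (𝓝 0) := by
    have h := (tendsto_zero_of_add_mul_le hε (fun k => by positivity) (hstep p hp) hr).sqrt
    rw [tendsto_zero_iff_norm_tendsto_zero]
    simpa using h
  have hxp : ∀ k, ‖x k - p‖ ≤ ‖x 0 - p‖ := fun k =>
    le_of_sq_le_sq (hanti p hp (Nat.zero_le k)) (norm_nonneg _)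
  have hxR : ∀ k, ‖x k‖ ≤ ‖x 0 - p‖ + ‖p‖ := fun k => by
    have := norm_add_le (x k - p) p
    rw [sub_add_cancel] at this
    linarith [hxp k]
  have hJR : ∀ k, ‖J (x k)‖ ≤ ‖x 0 - p‖ / (1 + γ * α) + ‖J p‖ := fun k => by
    have h1 := norm_add_le (J (x k) - J p) (J p)
    rw [sub_add_cancel] at h1
    have h2 : ‖J (x k) - J p‖ ≤ ‖x 0 - p‖ / (1 + γ * α) := by
      rw [le_div_iff₀' hα]
      exact (hA.1.mul_norm_sub_le hγ (hJA _) (hJA _)).trans (hxp k)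
    linarith
  set R₁ := ‖x 0 - p‖ + ‖p‖
  set R₂ := ‖x 0 - p‖ / (1 + γ * α) + ‖J p‖
  have hlim : ∀ U : Ultrafilter ℕ, (U : Filter ℕ) ≤ atTop → ∀ z : H,
      (∀ v, Tendsto (fun k => inner ℝ (x k) v) U (𝓝 (inner ℝ z v))) →
      w z = 0 ∧ ∀ v, Tendsto (fun k => inner ℝ (J (x k)) v) U (𝓝 (inner ℝ (J z) v)) := by
    intro U hU z hz
    obtain ⟨q, hq⟩ := exists_tendsto_inner_of_norm_le U hJR
    have hmem := mem_of_weak_limit (l := (U : Filter ℕ)) hA hB hαβ hγ hδ hα hβ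
      (x := fun k => J (x k)) (w := fun k => w (x k)) (a := fun k => γ⁻¹ • (x k - J (x k)))
      (s := fun k => δ⁻¹ • w (x k)) (R := max R₂ (γ⁻¹ * (R₁ + R₂))) (p := q)
      (c := γ⁻¹ • (z - q)) (fun k => (hJR k).trans (le_max_left _ _)) (fun k => ?_)
      (fun k => hJA _) (fun k => hJB _) (hw.mono_left hU)
      (by simpa using (hw.const_smul δ⁻¹).mono_left hU) hq (fun v => ?_)
    · obtain ⟨rfl, hwz⟩ := eq_and_eq_zero_of_mem hA.1 hB.1 hγ hδ hα hβ hJA hJB hmem.1 hmem.2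
      exact ⟨hwz, hq⟩
    · refine le_max_of_le_right ?_
      rw [norm_smul, Real.norm_of_nonneg (inv_nonneg.2 hγ.le)]
      exact mul_le_mul_of_nonneg_left
        ((norm_sub_le _ _).trans (add_le_add (hxR k) (hJR k))) (inv_nonneg.2 hγ.le)
    · simpa only [inner_smul_left, inner_sub_left] using ((hz v).sub (hq v)).const_mul _
  obtain ⟨xs, hxs, hconv⟩ := exists_tendsto_inner_of_dist_tendsto hdist hxR
    fun U hU z hz => (hlim U hU z hz).1
  refine ⟨xs, hxs, hconv, fun v => ?_⟩
  rw [tendsto_iff_ultrafilter]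
  exact fun U hU => (hlim U hU xs fun v => (hconv v).mono_left hU).2 v

end SetValuedOp

end Iteration

/-! ### The adaptive Douglas–Rachford operator -/

namespace SetValuedOp

theorem relaxedResolvent_eq_singleton {H : Type*} [NormedAddCommGroup H] [InnerProductSpace ℝ H]
    {A : SetValuedOp H} {z x : H} (h : A.resolvent z = {x}) (lam : ℝ) :
    relaxedResolvent lam A z = {(1 - lam) • z + lam • x} := by
  change (1 - lam) • ({z} : Set H) + lam • A.resolvent z = _
  rw [h, Set.smul_set_singleton, Set.smul_set_singleton, Set.singleton_add_singleton]

/-- With `lam - 1 = δ / γ` and `mu - 1 = γ / δ`, a step moves `z` by a multiple of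
`J₁ z - J₂ (R₁ z)`, where `R₁ z = J₁ z - (δ / γ) • (z - J₁ z)`. -/
theorem aDR_eq_singleton {H : Type*} [NormedAddCommGroup H] [InnerProductSpace ℝ H]
    {A B : SetValuedOp H} {γ δ : ℝ} (hγ : γ ≠ 0) (hδ : δ ≠ 0) {z x y : H}
    (hx : (γ • A : SetValuedOp H).resolvent z = {x})
    (hy : (δ • B : SetValuedOp H).resolvent (x - δ • γ⁻¹ • (z - x)) = {y}) (κ : ℝ) :
    aDR A B γ δ (1 + δ / γ) (1 + γ / δ) κ z = {z - (κ * (1 + γ / δ)) • (x - y)} := by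
  have e : (1 - (1 + δ / γ)) • z + (1 + δ / γ) • x = x - δ • γ⁻¹ • (z - x) := by
    match_scalars <;> field_simp <;> ring
  change (1 - κ) • ({z} : Set H) + κ • (⋃ u ∈ relaxedResolvent (1 + δ / γ) (γ • A) z,
    relaxedResolvent (1 + γ / δ) (δ • B) u) = _
  rw [relaxedResolvent_eq_singleton hx, Set.biUnion_singleton, e,
    relaxedResolvent_eq_singleton hy, Set.smul_set_singleton, Set.smul_set_singleton,
    Set.singleton_add_singleton]
  congr 1
  match_scalars <;> field_simp <;> ring

end SetValuedOp

/-- The parameter conditions make `Id + γ A` and `Id + δ B` strongly monotone. -/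
theorem one_add_mul_pos {α β γ δ : ℝ} (hαβ : 0 ≤ α + β) (hγ : 0 < γ) (hδ : 0 < δ)
    (h_zero : α + β = 0 → δ * (1 + 2 * γ * α) = γ)
    (h_pos : 0 < α + β → (γ + δ) ^ 2 < 4 * γ * δ * (1 + γ * α) * (1 + δ * β)) :
    0 < 1 + γ * α ∧ 0 < 1 + δ * β := by
  rcases hαβ.eq_or_lt with h0 | h0
  · have hz := h_zero h0.symm
    obtain rfl : β = -α := by linarith
    constructor
    · refine pos_of_mul_pos_right (a := δ) ?_ hδ.le
      linarith
    · refine pos_of_mul_pos_right (a := γ) ?_ hγ.le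
      linarith
  · have h := (sq_nonneg (γ + δ)).trans_lt (h_pos h0)
    rw [mul_assoc] at h
    have h2 : 0 < (1 + γ * α) * (1 + δ * β) := pos_of_mul_pos_right h (by positivity)
    rcases pos_and_pos_or_neg_and_neg_of_mul_pos h2 with h3 | ⟨h3, h4⟩
    · exact h3
    · -- both factors negative would force `α < 0` and `β < 0`
      exfalso
      have h5 : α < 0 := by
        by_contra! hc
        linarith [mul_nonneg hγ.le hc]
      have h6 : β < 0 := by
        by_contra! hc
        linarith [mul_nonneg hδ.le hc]
      linarith

theorem theorem4p3 {H : Type*} [NormedAddCommGroup H] [InnerProductSpace ℝ H] [CompleteSpace H]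
    (A B : SetValuedOp H) (α β γ δ lam mu κ : ℝ)
    (hA : A.IsMaximallyMonotone α) (hB : B.IsMaximallyMonotone β)
    (hαβ : 0 ≤ α + β) (hzer : (A + B : SetValuedOp H).zer.Nonempty)
    (hγ : 0 < γ) (hδ : 0 < δ) (hlam : lam = 1 + δ / γ) (hmu : mu = 1 + γ / δ)
    (h_zero : α + β = 0 → δ * (1 + 2 * γ * α) = γ)
    (h_pos : 0 < α + β → (γ + δ) ^ 2 < 4 * γ * δ * (1 + γ * α) * (1 + δ * β))
    (hκ : κ ∈ Set.Ioo 0 (kappaBar α β γ δ)) :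
    -- the resolvent of `γ A` and the aDR operator are single-valued with full domain
    ∃ J₁ T : H → H,
      (∀ z, (γ • A : SetValuedOp H).resolvent z = {J₁ z}) ∧
      (∀ z, SetValuedOp.aDR A B γ δ lam mu κ z = {T z}) ∧
      ∀ x : ℕ → H, (∀ k, x (k + 1) = T (x k)) →
        ∃ xs : H, WeaklyConverges x xs ∧
          xs ∈ (SetValuedOp.aDR A B γ δ lam mu κ).Fix ∧
          WeaklyConverges (fun k => J₁ (x k)) (J₁ xs) ∧
          J₁ xs ∈ (A + B : SetValuedOp H).zer := by
  subst hlam hmu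
  obtain ⟨hα, hβ⟩ := one_add_mul_pos hαβ hγ hδ h_zero h_pos
  obtain ⟨c, hκc, hc⟩ := exists_lt_mul_norm_sub_sq_le (H := H) hαβ hγ hδ h_zero hκ.2
  choose J₁ hJ₁ using fun z => hA.exists_mem_resolvent hγ hα z
  choose J₂ hJ₂ using fun z => hB.exists_mem_resolvent hδ hβ z
  set w : H → H := fun z => J₁ z - J₂ (J₁ z - δ • γ⁻¹ • (z - J₁ z)) with hw
  have hT : ∀ z, SetValuedOp.aDR A B γ δ (1 + δ / γ) (1 + γ / δ) κ z =
      {z - (κ * (1 + γ / δ)) • w z} := fun z =>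
    SetValuedOp.aDR_eq_singleton hγ.ne' hδ.ne' (hA.1.resolvent_eq_singleton hγ hα (hJ₁ z))
      (hB.1.resolvent_eq_singleton hδ hβ (hJ₂ _)) κ
  have hwB : ∀ z, δ⁻¹ • w z - γ⁻¹ • (z - J₁ z) ∈ B (J₁ z - w z) := fun z => by
    have h := hJ₂ (J₁ z - δ • γ⁻¹ • (z - J₁ z))
    have e : δ⁻¹ • w z - γ⁻¹ • (z - J₁ z) = δ⁻¹ • (J₁ z - δ • γ⁻¹ • (z - J₁ z) -
        J₂ (J₁ z - δ • γ⁻¹ • (z - J₁ z))) := by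
      simp only [hw]
      match_scalars <;> field_simp
    rw [e]
    simpa only [hw, sub_sub_cancel] using h
  have hcoc : ∀ z p, w p = 0 → c * ‖w z‖ ^ 2 ≤ inner ℝ (z - p) (w z) := by
    intro z p hp
    have h1 := hA.1.le_inner (hJ₁ z) (hJ₁ p)
    have h2 := hB.1.le_inner (hwB z) (hwB p)
    rw [hp, smul_zero, zero_sub, sub_zero] at h2
    have e : J₁ z - J₁ p - (J₁ z - w z - J₁ p) = w z := by abel
    have h3 := hc (J₁ z - J₁ p) (J₁ z - w z - J₁ p)
    have h4 := h3.trans (le_inner_of_le_inner hγ (Z := z - p) ?_ ?_ h1 h2 hδ.ne')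
    · rwa [e] at h4
    · match_scalars <;> field_simp <;> ring
    · rw [e]
      module
  have hfix : ∃ p, w p = 0 := by
    obtain ⟨p, hp⟩ := hzer
    obtain ⟨a, ha, b, hb, hab⟩ := Set.mem_add.1 (show (0 : H) ∈ A p + B p from hp)
    obtain rfl := eq_neg_of_add_eq_zero_right hab
    refine ⟨p + γ • a, (SetValuedOp.eq_and_eq_zero_of_mem hA.1 hB.1 hγ hδ hα hβ
      hJ₁ hwB (p := p) ?_ ?_).2⟩
    · simpa [hγ.ne'] using ha
    · simpa [hγ.ne'] using hb
  refine ⟨J₁, fun z => z - (κ * (1 + γ / δ)) • w z,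
    fun z => hA.1.resolvent_eq_singleton hγ hα (hJ₁ z), hT, fun x hx => ?_⟩
  obtain ⟨xs, hxs, hconv, hJconv⟩ :=
    SetValuedOp.exists_weak_limit_of_iterate hA hB hαβ hγ hδ hα hβ hJ₁ hwB hcoc
      (mul_pos hκ.1 (by positivity)) hκc hfix hx
  refine ⟨xs, tendsto_toWeakSpace_iff_inner.2 hconv, ?_, tendsto_toWeakSpace_iff_inner.2 hJconv, ?_⟩
  · change xs ∈ SetValuedOp.aDR A B γ δ (1 + δ / γ) (1 + γ / δ) κ xs
    rw [hT, hxs]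
    simp
  · have h := hwB xs
    rw [hxs, smul_zero, zero_sub, sub_zero] at h
    exact Set.mem_add.2 ⟨_, hJ₁ xs, _, h, add_neg_cancel _⟩
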